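/- Let $\Gamma$ be a finite connected $k$-regular graph on $n$ vertices, with adjacency matrix $A$, having exactly five distinct eigenvalues $\theta_0(=k)>\theta_1>\theta_2>\theta_3>\theta_4$ with multiplicities $m_0(=1),m_1,\dots,m_4$, and suppose that $\theta_1+\theta_4=\theta_2+\theta_3$. On real polynomials put $\langle p,q\rangle=\frac1n\operatorname{tr}(p(A)q(A))=\frac1n\sum_{i=0}^4 m_i\,p(\theta_i)q(\theta_i)$. Let $p_0,\dots,p_4$ be the predistance polynomials of $\Gamma$, that is, the orthogonal polynomials with respect to this product with $\deg p_i=i$ and $\langle p_i,p_i\rangle=p_i(k)$, and let $\gamma_2=\langle x p_1,p_2\rangle/\langle p_2,p_2\rangle$. Let $\overline{n_2}$ be the average, over the vertices $u$, of the number of vertices at distance at most $2$ from $u$ (including $u$). Put $$s_1(x)=x^2-(\theta_2+\theta_3-\gamma_2)x+\theta_2\theta_3,\qquad s_2(x)=x^2-(\theta_2+\theta_3)x+\gamma_2-\theta_2\theta_3,$$ and, for $j=1,2$, $$\tau_j=\frac{s_j(\theta_0)\sum_{i=1}^4 m_i s_j(\theta_i)-\sum_{i=1}^4 m_i s_j(\theta_i)^2}{s_j(\theta_0)(n-1)-\sum_{i=1}^4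 m_i s_j(\theta_i)},\qquad \Phi(\tau_j)=\frac{n\,(s_j(\theta_0)-\tau_j)^2}{\sum_{i=0}^4 m_i\,(s_j(\theta_i)-\tau_j)^2}.$$ Then the denominators of $\tau_j$ and of $\Phi(\tau_j)$ are nonzero, and $$\overline{n_2}\ \ge\ \Phi(\tau_j),\qquad j=1,2.$$ Call $\Gamma$ $2$-partially distance-regular if its diameter is at least $2$ and, for $i=0,1,2$, $p_i(A)$ is the distance-$i$ matrix of $\Gamma$ (the $0$-$1$ matrix whose $(u,v)$ entry is $1$ iff $u,v$ are at distance $i$). Equality holds for $j=1$ if and only if $\Gamma$ is $2$-partially distance-regular and its distance-$2$ graph is strongly regular. Equality holds for $j=2$ if and only if $\Gamma$ is $2$-partially distance-regular and its distance-$1$-or-$2$ graph is strongly regular. Here the distance-$2$ (distance-$1$-or-$2$) graph has the same vertices, two of them being adjacent iff their distance in $\Gamma$ is $2$ (is $1$ or $2$); and a strongly regular graph is a regular graph, neither complete nor edgeless, in which the number of common neighbours of two distinct vertices depends only on whether they are adjacent. -/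

import Mathlib

open Polynomial

noncomputable section

namespace SpectralExcess

variable {V : Type*}

/-- The graph on `V` in which `u ≠ v` are adjacent iff their distance in `G` lies in `S`.
`S = {2}` gives the distance-2 graph and `S = {1, 2}` the distance-1-or-2 graph. -/
def distanceGraph (G : SimpleGraph V) (S : Set ℕ) : SimpleGraph V where
  Adj u v := u ≠ v ∧ G.dist u v ∈ S
  symm := ⟨fun u v h => ⟨h.1.symm, by rw [SimpleGraph.dist_comm]; exact h.2⟩⟩
  loopless := ⟨fun _ h => h.1 rfl⟩

/-- The distance-`i` matrix of a connected graph. -/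
def distanceMatrix (G : SimpleGraph V) (i : ℕ) : Matrix V V ℝ :=
  Matrix.of fun u v => if G.dist u v = i then 1 else 0

variable [Fintype V]

/-- The average over all vertices `u` of the number of vertices at distance at most `i`
from `u` (in a connected graph). -/
def avgBall (G : SimpleGraph V) (i : ℕ) : ℝ :=
  (∑ u : V, ((Finset.univ.filter fun v : V => G.dist u v ≤ i).card : ℝ)) / Fintype.card V

open Classical in
/-- Strongly regular: neither complete nor edgeless, regular, and the number of common
neighbours of two distinct vertices depends only on whether they are adjacent. -/
def IsStronglyRegular (G : SimpleGraph V) : Prop :=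
  G ≠ ⊤ ∧ G ≠ ⊥ ∧ ∃ k l μ : ℕ, G.IsSRGWith (Fintype.card V) k l μ

variable [DecidableEq V] (G : SimpleGraph V) [DecidableRel G.Adj]

/-- `⟨p, q⟩ = (1/n) tr (p(A) q(A))`, where `A` is the adjacency matrix. -/
def polyInner (p q : ℝ[X]) : ℝ :=
  (aeval (G.adjMatrix ℝ) p * aeval (G.adjMatrix ℝ) q).trace / Fintype.card V

/-- The monic polynomials obtained from `1, X, X ^ 2, …` by Gram-Schmidt orthogonalization. -/
def orthoPoly : ℕ → ℝ[X]
  | i => X ^ i - ∑ j : Fin i,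
      C (polyInner G (X ^ i) (orthoPoly j) / polyInner G (orthoPoly j) (orthoPoly j)) *
        orthoPoly j
  termination_by i => i
  decreasing_by all_goals exact j.2

/-- The predistance polynomials of a `k`-regular graph: the orthogonal polynomials rescaled so
that `⟨p_i, p_i⟩ = p_i(k)`. -/
def predistancePoly (k i : ℕ) : ℝ[X] :=
  C ((orthoPoly G i).eval (k : ℝ) / polyInner G (orthoPoly G i) (orthoPoly G i)) * orthoPoly G i

/-- The preintersection number `γ_i`: the Fourier coefficient of `X p_{i-1}` in terms of `p_i`
(used for `1 ≤ i`). -/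
def preGamma (k i : ℕ) : ℝ :=
  polyInner G (X * predistancePoly G k (i - 1)) (predistancePoly G k i) /
    polyInner G (predistancePoly G k i) (predistancePoly G k i)

/-- A `k`-regular graph is `m`-partially distance-regular if `m` is at most its diameter and
`p_i(A) = A_i` for all `i ≤ m`. -/
def IsPartiallyDistanceRegular (k m : ℕ) : Prop :=
  m ≤ G.diam ∧
    ∀ i ≤ m, aeval (G.adjMatrix ℝ) (predistancePoly G k i) = distanceMatrix G i

/-- The multiplicity of `t` as an eigenvalue of the adjacency matrix. -/
def eigMult (t : ℝ) : ℕ :=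
  Module.finrank ℝ (Module.End.eigenspace (Matrix.toLin' (G.adjMatrix ℝ)) t)

/-- `x² - (θ₂ + θ₃ - γ₂) x + θ₂ θ₃`. -/
def s₁ (k : ℕ) (θ : Fin 5 → ℝ) : ℝ[X] :=
  X ^ 2 - C (θ 2 + θ 3 - preGamma G k 2) * X + C (θ 2 * θ 3)

/-- `x² - (θ₂ + θ₃) x + γ₂ - θ₂ θ₃`. -/
def s₂ (k : ℕ) (θ : Fin 5 → ℝ) : ℝ[X] :=
  X ^ 2 - C (θ 2 + θ 3) * X + C (preGamma G k 2 - θ 2 * θ 3)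

/-- `∑ i = 1, …, 4` of `m_i s(θ_i)`. -/
def sum₁ (θ : Fin 5 → ℝ) (s : ℝ[X]) : ℝ :=
  ∑ i : Fin 4, (eigMult G (θ i.succ) : ℝ) * s.eval (θ i.succ)

/-- `∑ i = 1, …, 4` of `m_i s(θ_i)²`. -/
def sum₂ (θ : Fin 5 → ℝ) (s : ℝ[X]) : ℝ :=
  ∑ i : Fin 4, (eigMult G (θ i.succ) : ℝ) * (s.eval (θ i.succ)) ^ 2

/-- The denominator of `τ`. -/
def tauDen (θ : Fin 5 → ℝ) (s : ℝ[X]) : ℝ :=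
  s.eval (θ 0) * ((Fintype.card V : ℝ) - 1) - sum₁ G θ s

/-- The number `τ` attached to the polynomial `s`. -/
def tau (θ : Fin 5 → ℝ) (s : ℝ[X]) : ℝ :=
  (s.eval (θ 0) * sum₁ G θ s - sum₂ G θ s) / tauDen G θ s

/-- The denominator of `Φ(t)`: the sum over `i = 0, …, 4` of `m_i (s(θ_i) - t)²`. -/
def PhiDen (θ : Fin 5 → ℝ) (s : ℝ[X]) (t : ℝ) : ℝ :=
  ∑ i : Fin 5, (eigMult G (θ i) : ℝ) * (s.eval (θ i) - t) ^ 2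

/-- `Φ(t) = n (s(θ₀) - t)² / ∑ m_i (s(θ_i) - t)²`. -/
def Phi (θ : Fin 5 → ℝ) (s : ℝ[X]) (t : ℝ) : ℝ :=
  (Fintype.card V : ℝ) * (s.eval (θ 0) - t) ^ 2 / PhiDen G θ s t

end SpectralExcess

end

open Polynomial

noncomputable section

/-! Let D be the 0-1 matrix of pairs at distance at most 2. A quadratic in A is supported on D, so
the entrywise inner product of Q = s(A) - tI with D is the sum of all entries of Q, namely n(s(k) -
t). The squared norms of Q and D are `PhiDen` and n times the average ball size. Cauchy-Schwarz
gives the bound for every t, with equality exactly when Q is a multiple of D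
(`Phi_quadratic_le_avgBall`). The choice of τ matters only for equality. If s(A) - tI = cD, then it
is orthogonal to s(A) - s(k)I, whose rows sum to zero. This condition is linear in t with root τ, so
equality at τ means that A² - bA + dI = cD for some d and c, and the constant term of s plays no
role (`avgBall_eq_Phi_tau_iff`). Such an identity forces c = γ₂ and makes c(A₂ + εA) equal to A² -
(θ₁ + θ₄)A - kI, with ε = 0 for s₁ and ε = 1 for s₂. As θ₁ + θ₄ = θ₂ + θ₃, this parabola takes just
two values on the nontrivial eigenvalues, which is strong regularity. Conversely, a parabola with at
most two values there must have that axis of symmetry (`exists_quadratic_eq_smul_ballMatrix_iff`).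
-/

/-! ### Polynomials in a real symmetric matrix: traces and eigenvectors. -/

theorem Matrix.IsHermitian.iSup_eigenspace_toLin' {V : Type*} [Fintype V] [DecidableEq V]
    {A : Matrix V V ℝ} (hA : A.IsHermitian) {ι : Type*} {θ : ι → ℝ}
    (hspec : spectrum ℝ A = Set.range θ) :
    ⨆ i, Module.End.eigenspace (Matrix.toLin' A) (θ i) = ⊤ := by
  rw [eq_top_iff]
  rintro x -
  have hx := congrArg WithLp.ofLp (hA.eigenvectorBasis.sum_repr (WithLp.toLp 2 x))
  rw [WithLp.ofLp_sum] at hx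
  rw [← show _ = x from hx]
  refine Submodule.sum_mem _ fun j _ => ?_
  rw [WithLp.ofLp_smul]
  refine Submodule.smul_mem _ _ ?_
  obtain ⟨i, hi⟩ : hA.eigenvalues j ∈ Set.range θ :=
    hspec ▸ hA.eigenvalues_mem_spectrum_real j
  refine Submodule.mem_iSup_of_mem i ?_
  rw [Module.End.mem_eigenspace_iff, Matrix.toLin'_apply, hA.mulVec_eigenvectorBasis, hi]

theorem Matrix.toLin'_aeval {V : Type*} [Fintype V] [DecidableEq V]
    (A : Matrix V V ℝ) (p : ℝ[X]) :
    Matrix.toLin' (aeval A p) = aeval (Matrix.toLin' A) p :=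
  (aeval_algHom_apply (Matrix.toLinAlgEquiv' : Matrix V V ℝ ≃ₐ[ℝ] _).toAlgHom A p).symm

theorem Matrix.aeval_mulVec_of_eigenvector {V : Type*} [Fintype V] [DecidableEq V]
    {A : Matrix V V ℝ} {x : V → ℝ} {t : ℝ} (hx : A.mulVec x = t • x) (p : ℝ[X]) :
    (aeval A p).mulVec x = p.eval t • x := by
  rw [← Matrix.toLin'_apply, Matrix.toLin'_aeval]
  exact Module.End.aeval_apply_of_mem_apply_eq_smul (by rwa [Matrix.toLin'_apply])

theorem Matrix.IsHermitian.trace_aeval_eq_sum {V : Type*} [Fintype V] [DecidableEq V]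
    {A : Matrix V V ℝ} (hA : A.IsHermitian) {ι : Type*} [Fintype ι] [DecidableEq ι]
    {θ : ι → ℝ} (hθ : Function.Injective θ)
    (hspec : spectrum ℝ A = Set.range θ) (p : ℝ[X]) :
    (aeval A p).trace =
      ∑ i, (Module.finrank ℝ (Module.End.eigenspace (Matrix.toLin' A) (θ i)) : ℝ) *
        p.eval (θ i) := by
  have hint : DirectSum.IsInternal fun i => Module.End.eigenspace (Matrix.toLin' A) (θ i) :=
    DirectSum.isInternal_submodule_of_iSupIndep_of_iSup_eq_top
      ((Module.End.eigenspaces_iSupIndep _).comp hθ) (hA.iSup_eigenspace_toLin' hspec)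
  have hp : ∀ i, ∀ x ∈ Module.End.eigenspace (Matrix.toLin' A) (θ i),
      aeval (Matrix.toLin' A) p x = p.eval (θ i) • x := fun i x hx =>
    Module.End.aeval_apply_of_mem_apply_eq_smul (Module.End.mem_eigenspace_iff.1 hx)
  have hmaps : ∀ i, Set.MapsTo (aeval (Matrix.toLin' A) p)
      (Module.End.eigenspace (Matrix.toLin' A) (θ i))
      (Module.End.eigenspace (Matrix.toLin' A) (θ i)) := fun i x hx => by
    rw [SetLike.mem_coe, hp i x hx]
    exact Submodule.smul_mem _ _ hx
  rw [← Matrix.trace_toLin'_eq, Matrix.toLin'_aeval, LinearMap.trace_eq_sum_trace_restrict hint hmaps]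
  refine Finset.sum_congr rfl fun i _ => ?_
  have : (aeval (Matrix.toLin' A) p).restrict (hmaps i) = p.eval (θ i) • LinearMap.id := by
    refine LinearMap.ext fun x => Subtype.ext ?_
    exact hp i x x.2
  rw [this, map_smul, LinearMap.trace_id, smul_eq_mul, mul_comm]

theorem Matrix.IsSymm.aeval {V : Type*} [Fintype V] [DecidableEq V]
    {A : Matrix V V ℝ} (hA : A.IsSymm) (p : ℝ[X]) : (aeval A p).IsSymm := by
  induction p using Polynomial.induction_on' with
  | add p q hp hq => rw [map_add]; exact hp.add hq
  | monomial n a =>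
    rw [aeval_monomial, Algebra.algebraMap_eq_smul_one, smul_mul_assoc, one_mul]
    exact (hA.pow n).smul a

theorem Matrix.IsSymm.trace_mul_eq_sum {V : Type*} [Fintype V]
    {M N : Matrix V V ℝ} (hN : N.IsSymm) :
    (M * N).trace = ∑ u, ∑ v, M u v * N u v := by
  simp only [Matrix.trace, Matrix.diag, Matrix.mul_apply]
  exact Finset.sum_congr rfl fun u _ => Finset.sum_congr rfl fun v _ => by rw [hN.apply u v]

theorem Matrix.IsSymm.eq_zero_of_trace_mul_self {V : Type*} [Fintype V]
    {M : Matrix V V ℝ} (hM : M.IsSymm) (h : (M * M).trace = 0) : M = 0 := by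
  rw [hM.trace_mul_eq_sum] at h
  ext u v
  have hu := (Finset.sum_eq_zero_iff_of_nonneg fun u _ =>
    Finset.sum_nonneg fun v _ => mul_self_nonneg (M u v)).1 h u (Finset.mem_univ u)
  have hv := (Finset.sum_eq_zero_iff_of_nonneg fun v _ =>
    mul_self_nonneg (M u v)).1 hu v (Finset.mem_univ v)
  exact mul_self_eq_zero.1 hv

theorem Matrix.IsHermitian.aeval_eq_zero_of_eval {V : Type*} [Fintype V] [DecidableEq V]
    {A : Matrix V V ℝ} (hA : A.IsHermitian) {ι : Type*} [Fintype ι] [DecidableEq ι]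
    {θ : ι → ℝ} (hθ : Function.Injective θ)
    (hspec : spectrum ℝ A = Set.range θ) {p : ℝ[X]} (hp : ∀ i, p.eval (θ i) = 0) :
    aeval A p = 0 := by
  have hs : A.IsSymm := by rwa [← Matrix.isHermitian_iff_isSymm]
  refine (hs.aeval p).eq_zero_of_trace_mul_self ?_
  rw [← map_mul, hA.trace_aeval_eq_sum hθ hspec]
  simp [hp]

theorem Matrix.exists_eigenvector_of_mem_spectrum {V : Type*} [Fintype V] [DecidableEq V]
    {A : Matrix V V ℝ} {t : ℝ} (ht : t ∈ spectrum ℝ A) :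
    ∃ x : V → ℝ, x ≠ 0 ∧ A.mulVec x = t • x := by
  rw [← Matrix.spectrum_toLin', ← Module.End.hasEigenvalue_iff_mem_spectrum] at ht
  obtain ⟨x, hx⟩ := ht.exists_hasEigenvector
  exact ⟨x, hx.2, by simpa using hx.apply_eq_smul⟩

theorem Matrix.mem_spectrum_of_eigenvector {V : Type*} [Fintype V] [DecidableEq V]
    {A : Matrix V V ℝ} {t : ℝ} {x : V → ℝ} (hx : x ≠ 0) (h : A.mulVec x = t • x) :
    t ∈ spectrum ℝ A := by
  rw [← Matrix.spectrum_toLin', ← Module.End.hasEigenvalue_iff_mem_spectrum]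
  exact Module.End.hasEigenvalue_of_hasEigenvector (x := x)
    ⟨by rw [Module.End.mem_eigenspace_iff, Matrix.toLin'_apply, h], hx⟩

/-! ### The spectrum of a connected regular graph. -/

namespace SpectralExcess

variable {V : Type*} [Fintype V] {G : SimpleGraph V} [DecidableRel G.Adj] {k : ℕ}

theorem adjMatrix_mulVec_one (hreg : G.IsRegularOfDegree k) :
    (G.adjMatrix ℝ).mulVec 1 = (k : ℝ) • 1 := by
  ext v
  simpa using G.adjMatrix_mulVec_const_apply_of_regular (a := (1 : ℝ)) hreg (v := v)

theorem exists_adj_of_degree_pos [Nonempty V] (hreg : G.IsRegularOfDegree k) (hk : 0 < k) :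
    ∃ u v, G.Adj u v := by
  let u : V := Classical.arbitrary V
  obtain ⟨v, h⟩ := (G.degree_pos_iff_exists_adj u).1 (by rw [hreg u]; exact hk)
  exact ⟨u, v, h⟩

theorem sum_eigenvector_eq_zero (hreg : G.IsRegularOfDegree k) {x : V → ℝ} {t : ℝ}
    (h : (G.adjMatrix ℝ).mulVec x = t • x) (ht : t ≠ k) : ∑ v, x v = 0 := by
  have h1 : (1 : V → ℝ) ⬝ᵥ (G.adjMatrix ℝ).mulVec x = k * ((1 : V → ℝ) ⬝ᵥ x) := by
    rw [Matrix.dotProduct_mulVec, ← Matrix.mulVec_transpose, SimpleGraph.transpose_adjMatrix,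
      adjMatrix_mulVec_one hreg, smul_dotProduct, smul_eq_mul]
  rw [h, dotProduct_smul, smul_eq_mul, one_dotProduct] at h1
  have h2 : (t - k) * ∑ v, x v = 0 := by linear_combination h1
  exact (mul_eq_zero.1 h2).resolve_left (sub_ne_zero.2 ht)

variable [DecidableEq V]

theorem sum_aeval_adjMatrix_row (hreg : G.IsRegularOfDegree k) (p : ℝ[X]) (u : V) :
    ∑ v, aeval (G.adjMatrix ℝ) p u v = p.eval (k : ℝ) := by
  have := congrFun (Matrix.aeval_mulVec_of_eigenvector (adjMatrix_mulVec_one hreg) p) u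
  simpa [Matrix.mulVec, dotProduct] using this

theorem lapMatrix_mulVec_of_eigenvector (hreg : G.IsRegularOfDegree k) {x : V → ℝ} {t : ℝ}
    (h : (G.adjMatrix ℝ).mulVec x = t • x) : (G.lapMatrix ℝ).mulVec x = ((k : ℝ) - t) • x := by
  ext v
  have := congrFun h v
  rw [SimpleGraph.adjMatrix_mulVec_apply] at this
  rw [SimpleGraph.lapMatrix_mulVec_apply, this, hreg v]
  simp [sub_mul]

/-- The Laplacian kI - A is positive semidefinite. -/
theorem eigenvalue_le_degree (hreg : G.IsRegularOfDegree k) {t : ℝ}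
    (ht : t ∈ spectrum ℝ (G.adjMatrix ℝ)) : t ≤ k := by
  obtain ⟨x, hx, h⟩ := Matrix.exists_eigenvector_of_mem_spectrum ht
  have h0 := (SimpleGraph.posSemidef_lapMatrix ℝ G).dotProduct_mulVec_nonneg x
  rw [lapMatrix_mulVec_of_eigenvector hreg h, dotProduct_smul, star_trivial, smul_eq_mul] at h0
  have h1 : 0 < x ⬝ᵥ x := by
    refine lt_of_le_of_ne (Finset.sum_nonneg fun i _ => mul_self_nonneg _) ?_
    exact fun h => hx (dotProduct_self_eq_zero.1 h.symm)
  nlinarith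

theorem degree_mem_spectrum [Nonempty V] (hreg : G.IsRegularOfDegree k) :
    (k : ℝ) ∈ spectrum ℝ (G.adjMatrix ℝ) :=
  Matrix.mem_spectrum_of_eigenvector one_ne_zero (adjMatrix_mulVec_one hreg)

theorem eq_of_degree_eigenvector (hconn : G.Connected) (hreg : G.IsRegularOfDegree k) {x : V → ℝ}
    (h : (G.adjMatrix ℝ).mulVec x = (k : ℝ) • x) (u v : V) : x u = x v := by
  have h0 := lapMatrix_mulVec_of_eigenvector hreg h
  rw [sub_self, zero_smul, SimpleGraph.lapMatrix_mulVec_eq_zero_iff_forall_reachable] at h0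
  exact h0 u v (hconn.preconnected u v)

theorem eigMult_degree (hconn : G.Connected) (hreg : G.IsRegularOfDegree k) :
    eigMult G k = 1 := by
  have := hconn.nonempty
  have h1 : (1 : V → ℝ) ∈ Module.End.eigenspace (Matrix.toLin' (G.adjMatrix ℝ)) (k : ℝ) := by
    rw [Module.End.mem_eigenspace_iff, Matrix.toLin'_apply, adjMatrix_mulVec_one hreg]
  refine finrank_eq_one (⟨1, h1⟩ : Module.End.eigenspace (Matrix.toLin' (G.adjMatrix ℝ)) (k : ℝ))
    (fun h => one_ne_zero (congrArg Subtype.val h)) ?_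
  rintro ⟨x, hx⟩
  rw [Module.End.mem_eigenspace_iff, Matrix.toLin'_apply] at hx
  let u : V := Classical.arbitrary V
  refine ⟨x u, Subtype.ext (funext fun v => ?_)⟩
  simpa using eq_of_degree_eigenvector hconn hreg hx u v

section Spectrum

variable {θ : Fin 5 → ℝ}

theorem theta_zero_eq (hconn : G.Connected) (hreg : G.IsRegularOfDegree k) (hθ : StrictAnti θ)
    (hspec : spectrum ℝ (G.adjMatrix ℝ) = Set.range θ) : θ 0 = k := by
  have := hconn.nonempty
  refine le_antisymm (eigenvalue_le_degree hreg (hspec ▸ Set.mem_range_self 0)) ?_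
  obtain ⟨i, hi⟩ : (k : ℝ) ∈ Set.range θ := hspec ▸ degree_mem_spectrum hreg
  exact hi ▸ hθ.antitone (Fin.zero_le i)

theorem trace_aeval_eq_sum_eigMult (hθ : StrictAnti θ)
    (hspec : spectrum ℝ (G.adjMatrix ℝ) = Set.range θ) (p : ℝ[X]) :
    (aeval (G.adjMatrix ℝ) p).trace = ∑ i, (eigMult G (θ i) : ℝ) * p.eval (θ i) :=
  (G.isHermitian_adjMatrix ℝ).trace_aeval_eq_sum hθ.injective hspec p

theorem aeval_adjMatrix_eq_zero_iff (hθ : StrictAnti θ)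
    (hspec : spectrum ℝ (G.adjMatrix ℝ) = Set.range θ) {p : ℝ[X]} :
    aeval (G.adjMatrix ℝ) p = 0 ↔ ∀ i, p.eval (θ i) = 0 := by
  refine ⟨fun h i => ?_, (G.isHermitian_adjMatrix ℝ).aeval_eq_zero_of_eval hθ.injective hspec⟩
  obtain ⟨x, hx, hx'⟩ := Matrix.exists_eigenvector_of_mem_spectrum
    (hspec ▸ Set.mem_range_self i : θ i ∈ spectrum ℝ (G.adjMatrix ℝ))
  have := Matrix.aeval_mulVec_of_eigenvector hx' p
  rw [h, Matrix.zero_mulVec] at this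
  exact (smul_eq_zero.1 this.symm).resolve_right hx

/-- Since (A - kI)p(A) = 0, each column of p(A) is a k-eigenvector, constant by connectedness;
symmetry then identifies the columns with one another. -/
theorem aeval_adjMatrix_const (hconn : G.Connected) (hreg : G.IsRegularOfDegree k)
    (hθ : StrictAnti θ) (hspec : spectrum ℝ (G.adjMatrix ℝ) = Set.range θ) {p : ℝ[X]}
    (hp : ∀ i, i ≠ 0 → p.eval (θ i) = 0) :
    ∃ z : ℝ, ∀ u v, aeval (G.adjMatrix ℝ) p u v = z := by
  have := hconn.nonempty
  have h0 : aeval (G.adjMatrix ℝ) ((X - C (k : ℝ)) * p) = 0 := by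
    rw [aeval_adjMatrix_eq_zero_iff hθ hspec]
    intro i
    by_cases hi : i = 0
    · simp [hi, theta_zero_eq hconn hreg hθ hspec]
    · simp [hp i hi]
  have hcol : ∀ u v w, aeval (G.adjMatrix ℝ) p u w = aeval (G.adjMatrix ℝ) p v w := by
    intro u v w
    refine eq_of_degree_eigenvector hconn hreg (x := fun u => aeval (G.adjMatrix ℝ) p u w) ?_ u v
    ext u
    have := congrFun (congrFun h0 u) w
    rw [map_mul, map_sub, aeval_X, aeval_C, sub_mul, Matrix.sub_apply, Matrix.mul_apply,
      Algebra.algebraMap_eq_smul_one, smul_mul_assoc, one_mul] at this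
    simpa [Matrix.mulVec, dotProduct, sub_eq_zero] using this
  have hsymm := (G.isSymm_adjMatrix.aeval p).apply
  let a : V := Classical.arbitrary V
  exact ⟨aeval (G.adjMatrix ℝ) p a a, fun u v => by rw [hcol u a v, ← hsymm, hcol v a a]⟩

theorem eigMult_pos (hspec : spectrum ℝ (G.adjMatrix ℝ) = Set.range θ) (i : Fin 5) :
    0 < eigMult G (θ i) := by
  have h : θ i ∈ spectrum ℝ (G.adjMatrix ℝ) := hspec ▸ Set.mem_range_self i
  rw [← Matrix.spectrum_toLin', ← Module.End.hasEigenvalue_iff_mem_spectrum] at h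
  rw [eigMult, Nat.pos_iff_ne_zero, Ne, Submodule.finrank_eq_zero]
  exact h

theorem degree_pos_of_spectrum (hreg : G.IsRegularOfDegree k) (hθ : StrictAnti θ)
    (hspec : spectrum ℝ (G.adjMatrix ℝ) = Set.range θ) : 0 < k := by
  by_contra! hk
  have hk : k = 0 := by omega
  have hA : aeval (G.adjMatrix ℝ) (X : ℝ[X]) = 0 := by
    rw [aeval_X]
    ext u v
    rw [SimpleGraph.adjMatrix_apply, if_neg, Matrix.zero_apply]
    intro h
    have := (G.degree_pos_iff_exists_adj u).2 ⟨v, h⟩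
    have := hreg u
    omega
  have h0 := (aeval_adjMatrix_eq_zero_iff hθ hspec).1 hA
  have := hθ (show (0 : Fin 5) < 1 by decide)
  simp only [eval_X] at h0
  rw [h0, h0] at this
  exact lt_irrefl _ this

/-- A - θ₄I has a symmetric square root M, obtained by interpolating √(x - θ₄) at the eigenvalues.
For adjacent u and v, the squared distance between rows u and v of M is -2θ₄ - 2, which is
nonnegative. -/
theorem theta_four_le (hθ : StrictAnti θ) (hspec : spectrum ℝ (G.adjMatrix ℝ) = Set.range θ)
    {u v : V} (huv : G.Adj u v) : θ 4 ≤ -1 := by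
  let p : ℝ[X] := Lagrange.interpolate Finset.univ θ fun i => √(θ i - θ 4)
  have hp : ∀ i, p.eval (θ i) = √(θ i - θ 4) := fun i =>
    Lagrange.eval_interpolate_at_node _ hθ.injective.injOn (Finset.mem_univ i)
  have h0 : aeval (G.adjMatrix ℝ) (p * p - (X - C (θ 4))) = 0 := by
    rw [aeval_adjMatrix_eq_zero_iff hθ hspec]
    intro i
    have : θ 4 ≤ θ i := hθ.antitone (Fin.le_last i)
    simp [hp, Real.mul_self_sqrt (sub_nonneg.2 this)]
  set M := aeval (G.adjMatrix ℝ) p with hM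
  have hMs : ∀ u v, M u v = M v u := fun u v => (G.isSymm_adjMatrix.aeval p).apply v u
  have hMM : ∀ a b, ∑ w, M a w * M b w = G.adjMatrix ℝ a b - if a = b then θ 4 else 0 := by
    intro a b
    have := congrFun (congrFun h0 a) b
    rw [map_sub, map_mul, map_sub, aeval_X, aeval_C, ← hM, Matrix.sub_apply, Matrix.mul_apply,
      Matrix.sub_apply, Matrix.algebraMap_matrix_apply, Matrix.zero_apply, sub_eq_zero] at this
    simpa only [hMs _ b, Algebra.algebraMap_self, RingHom.id_apply] using this
  have h1 : 0 ≤ ∑ w, (M u w - M v w) ^ 2 := Finset.sum_nonneg fun w _ => sq_nonneg _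
  have h2 : ∑ w, (M u w - M v w) ^ 2 =
      ∑ w, M u w * M u w + ∑ w, M v w * M v w - 2 * ∑ w, M u w * M v w := by
    rw [Finset.mul_sum, ← Finset.sum_add_distrib, ← Finset.sum_sub_distrib]
    exact Finset.sum_congr rfl fun w _ => by ring
  rw [h2, hMM, hMM, hMM] at h1
  simp [huv, huv.ne] at h1
  linarith

end Spectrum

/-! ### The ball matrix, the Cauchy-Schwarz bound and the role of τ. -/

theorem distanceMatrix_zero {V : Type*} [DecidableEq V] {G : SimpleGraph V}
    (hconn : G.Connected) : distanceMatrix G 0 = 1 := by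
  ext u v
  simp [distanceMatrix, hconn.dist_eq_zero_iff, Matrix.one_apply]

theorem distanceMatrix_one {V : Type*} (G : SimpleGraph V) [DecidableRel G.Adj] :
    distanceMatrix G 1 = G.adjMatrix ℝ := by
  ext u v
  simp [distanceMatrix, SimpleGraph.dist_eq_one_iff_adj]

/-- The 0-1 matrix of the pairs of vertices at distance at most 2. -/
def ballMatrix {V : Type*} (G : SimpleGraph V) : Matrix V V ℝ :=
  distanceMatrix G 0 + distanceMatrix G 1 + distanceMatrix G 2

theorem ballMatrix_apply {V : Type*} (G : SimpleGraph V) (u v : V) :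
    ballMatrix G u v = if G.dist u v ≤ 2 then 1 else 0 := by
  simp only [ballMatrix, distanceMatrix, Matrix.add_apply, Matrix.of_apply]
  rcases h : G.dist u v with _ | _ | _ | d <;> simp

variable {V : Type*} [Fintype V] {G : SimpleGraph V}

theorem sum_ballMatrix_mul_self [Nonempty V] :
    ∑ u, ∑ v, ballMatrix G u v * ballMatrix G u v = Fintype.card V * avgBall G 2 := by
  rw [avgBall, mul_div_cancel₀ _ (by simp [Fintype.card_ne_zero] : (Fintype.card V : ℝ) ≠ 0)]
  refine Finset.sum_congr rfl fun u _ => ?_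
  simp only [ballMatrix_apply, mul_ite, mul_one, mul_zero, Finset.sum_boole, ← ite_and,
    and_self]

theorem avgBall_pos [Nonempty V] (G : SimpleGraph V) (i : ℕ) : 0 < avgBall G i := by
  refine div_pos (Finset.sum_pos (fun u _ => ?_) Finset.univ_nonempty) (by simp [Fintype.card_pos])
  rw [Nat.cast_pos, Finset.card_pos]
  exact ⟨u, by simp⟩

variable [DecidableEq V] [DecidableRel G.Adj] {k : ℕ}

theorem aeval_quadratic (A : Matrix V V ℝ) (b e : ℝ) :
    aeval A (X ^ 2 - C b * X + C e : ℝ[X]) = A ^ 2 - b • A + e • (1 : Matrix V V ℝ) := by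
  simp [Algebra.algebraMap_eq_smul_one]

theorem adjMatrix_sq_apply_eq_zero (hconn : G.Connected) {u v : V} (h : 2 < G.dist u v) :
    (G.adjMatrix ℝ ^ 2) u v = 0 := by
  rw [pow_two, Matrix.mul_apply]
  refine Finset.sum_eq_zero fun w _ => ?_
  by_contra hne
  simp only [SimpleGraph.adjMatrix_apply, mul_ite, mul_one, mul_zero, ite_eq_right_iff,
    Classical.not_imp, one_ne_zero, not_false_eq_true, and_true] at hne
  have h1 := SimpleGraph.dist_eq_one_iff_adj.2 hne.1
  have h2 := SimpleGraph.dist_eq_one_iff_adj.2 hne.2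
  have := hconn.dist_triangle (u := u) (v := w) (w := v)
  omega

/-- I, A and A² all vanish at pairs farther than 2 apart. -/
theorem quadratic_mul_ballMatrix (hconn : G.Connected) (b e : ℝ) (u v : V) :
    aeval (G.adjMatrix ℝ) (X ^ 2 - C b * X + C e : ℝ[X]) u v * ballMatrix G u v =
      aeval (G.adjMatrix ℝ) (X ^ 2 - C b * X + C e : ℝ[X]) u v := by
  rw [ballMatrix_apply]
  split_ifs with h
  · rw [mul_one]
  · have h1 : ¬ G.Adj u v := fun h' => by
      rw [← SimpleGraph.dist_eq_one_iff_adj] at h'; omega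
    have h2 : u ≠ v := by rintro rfl; simp at h
    rw [aeval_quadratic]
    simp [adjMatrix_sq_apply_eq_zero hconn (not_le.1 h), h1, h2]

theorem sum_quadratic_mul_ballMatrix (hconn : G.Connected) (hreg : G.IsRegularOfDegree k)
    (b e : ℝ) :
    ∑ u, ∑ v, aeval (G.adjMatrix ℝ) (X ^ 2 - C b * X + C e : ℝ[X]) u v * ballMatrix G u v =
      Fintype.card V * (X ^ 2 - C b * X + C e : ℝ[X]).eval (k : ℝ) := by
  simp_rw [quadratic_mul_ballMatrix hconn, sum_aeval_adjMatrix_row hreg]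
  rw [Finset.sum_const, Finset.card_univ, nsmul_eq_mul]

section Spectrum

variable {θ : Fin 5 → ℝ}

theorem quadratic_not_all_zero (hθ : StrictAnti θ) (b e : ℝ) :
    ¬ ∀ i, (X ^ 2 - C b * X + C e : ℝ[X]).eval (θ i) = 0 := by
  intro h
  have h0 := h 0
  have h1 := h 1
  have h2 := h 2
  simp only [eval_add, eval_sub, eval_mul, eval_C, eval_X, eval_pow] at h0 h1 h2
  have h01 := hθ (show (0 : Fin 5) < 1 by decide)
  have h12 := hθ (show (1 : Fin 5) < 2 by decide)
  have e1 : (θ 0 - θ 1) * (θ 0 + θ 1 - b) = 0 := by linear_combination h0 - h1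
  have e2 : (θ 1 - θ 2) * (θ 1 + θ 2 - b) = 0 := by linear_combination h1 - h2
  have e1 := (mul_eq_zero.1 e1).resolve_left (by linarith)
  have e2 := (mul_eq_zero.1 e2).resolve_left (by linarith)
  linarith

theorem quadratic_sub_C (b e t : ℝ) :
    (X ^ 2 - C b * X + C e - C t : ℝ[X]) = X ^ 2 - C b * X + C (e - t) := by
  rw [C_sub]; ring

theorem trace_quadratic_mul_self (hθ : StrictAnti θ)
    (hspec : spectrum ℝ (G.adjMatrix ℝ) = Set.range θ) (s : ℝ[X]) (t : ℝ) :
    (aeval (G.adjMatrix ℝ) ((s - C t) * (s - C t))).trace = PhiDen G θ s t := by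
  rw [trace_aeval_eq_sum_eigMult hθ hspec, PhiDen]
  exact Finset.sum_congr rfl fun i _ => by simp [pow_two]

theorem PhiDen_quadratic_pos (hθ : StrictAnti θ)
    (hspec : spectrum ℝ (G.adjMatrix ℝ) = Set.range θ) (b e t : ℝ) :
    0 < PhiDen G θ (X ^ 2 - C b * X + C e) t := by
  have hnn : ∀ i ∈ Finset.univ, 0 ≤ (eigMult G (θ i) : ℝ) *
      ((X ^ 2 - C b * X + C e : ℝ[X]).eval (θ i) - t) ^ 2 := fun i _ => by positivity
  refine lt_of_le_of_ne (Finset.sum_nonneg hnn) fun h => ?_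
  refine quadratic_not_all_zero hθ b (e - t) fun i => ?_
  have := (Finset.sum_eq_zero_iff_of_nonneg hnn).1 h.symm i (Finset.mem_univ i)
  have hm : (eigMult G (θ i) : ℝ) ≠ 0 := by exact_mod_cast (eigMult_pos hspec i).ne'
  have := pow_eq_zero_iff (two_ne_zero) |>.1 ((mul_eq_zero.1 this).resolve_left hm)
  rw [← quadratic_sub_C, eval_sub, eval_C, this]

/-- Cauchy-Schwarz for `s(A) - t` and the ball matrix, with its equality case. -/
theorem Phi_quadratic_le_avgBall (hconn : G.Connected) (hreg : G.IsRegularOfDegree k)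
    (hθ : StrictAnti θ) (hspec : spectrum ℝ (G.adjMatrix ℝ) = Set.range θ) (b e t : ℝ) :
    Phi G θ (X ^ 2 - C b * X + C e) t ≤ avgBall G 2 ∧
      (avgBall G 2 = Phi G θ (X ^ 2 - C b * X + C e) t ↔
        ∃ c : ℝ, aeval (G.adjMatrix ℝ) (X ^ 2 - C b * X + C (e - t) : ℝ[X]) =
          c • ballMatrix G) := by
  have := hconn.nonempty
  set s : ℝ[X] := X ^ 2 - C b * X + C e with hs
  set q : ℝ[X] := X ^ 2 - C b * X + C (e - t) with hq
  have hsq : s - C t = q := quadratic_sub_C b e t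
  set Q := aeval (G.adjMatrix ℝ) q with hQ
  have hP : 0 < PhiDen G θ s t := PhiDen_quadratic_pos hθ hspec b e t
  have hB := avgBall_pos G 2
  have hn : (0 : ℝ) < Fintype.card V := by simp [Fintype.card_pos]
  have hQQ : ∑ u, ∑ v, Q u v * Q u v = PhiDen G θ s t := by
    rw [← trace_quadratic_mul_self hθ hspec s t, hsq, map_mul,
      (G.isSymm_adjMatrix.aeval q).trace_mul_eq_sum]
  have hQD : ∑ u, ∑ v, Q u v * ballMatrix G u v = Fintype.card V * q.eval (k : ℝ) :=
    sum_quadratic_mul_ballMatrix hconn hreg b (e - t)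
  have hDD := sum_ballMatrix_mul_self (G := G)
  have hqk : s.eval (θ 0) - t = q.eval (k : ℝ) := by
    rw [theta_zero_eq hconn hreg hθ hspec, ← hsq, eval_sub, eval_C]
  have key : ∀ c : ℝ, ∑ u, ∑ v, (Q u v - c * ballMatrix G u v) ^ 2 =
      PhiDen G θ s t - 2 * c * (Fintype.card V * q.eval (k : ℝ)) +
        c ^ 2 * (Fintype.card V * avgBall G 2) := by
    intro c
    rw [← hQQ, ← hQD, ← hDD]
    simp only [Finset.mul_sum, ← Finset.sum_add_distrib, ← Finset.sum_sub_distrib]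
    exact Finset.sum_congr rfl fun u _ => Finset.sum_congr rfl fun v _ => by ring
  -- The coefficient of the orthogonal projection of Q onto the ball matrix, so this is the squared
  -- norm of the remainder.
  have key0 := key (q.eval (k : ℝ) / avgBall G 2)
  have hval : PhiDen G θ s t - 2 * (q.eval (k : ℝ) / avgBall G 2) *
      (Fintype.card V * q.eval (k : ℝ)) + (q.eval (k : ℝ) / avgBall G 2) ^ 2 *
        (Fintype.card V * avgBall G 2) =
      (PhiDen G θ s t / avgBall G 2) * (avgBall G 2 - Phi G θ s t) := by
    rw [Phi, hqk]
    field_simp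
    ring
  rw [hval] at key0
  have hnn : 0 ≤ (PhiDen G θ s t / avgBall G 2) * (avgBall G 2 - Phi G θ s t) := by
    rw [← key0]
    positivity
  have hpos := div_pos hP hB
  refine ⟨by linarith [nonneg_of_mul_nonneg_right hnn hpos], fun h => ?_, ?_⟩
  · refine ⟨q.eval (k : ℝ) / avgBall G 2, ?_⟩
    rw [h, sub_self, mul_zero, ← h] at key0
    ext u v
    have hu := (Finset.sum_eq_zero_iff_of_nonneg fun u _ =>
      Finset.sum_nonneg fun v _ => sq_nonneg _).1 key0 u (Finset.mem_univ u)
    have hv := (Finset.sum_eq_zero_iff_of_nonneg fun v _ => sq_nonneg _).1 hu v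
      (Finset.mem_univ v)
    rw [Matrix.smul_apply, smul_eq_mul]
    exact sub_eq_zero.1 (pow_eq_zero_iff two_ne_zero |>.1 hv)
  · rintro ⟨c, hc⟩
    have hc' : ∀ u v, Q u v = c * ballMatrix G u v := fun u v => by
      rw [hc, Matrix.smul_apply, smul_eq_mul]
    have e1 : c * (Fintype.card V * avgBall G 2) = Fintype.card V * q.eval (k : ℝ) := by
      rw [← hQD, ← hDD, Finset.mul_sum]
      refine Finset.sum_congr rfl fun u _ => ?_
      rw [Finset.mul_sum]
      exact Finset.sum_congr rfl fun v _ => by rw [hc']; ring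
    have e2 : c * avgBall G 2 = q.eval (k : ℝ) := mul_left_cancel₀ hn.ne' (by linear_combination e1)
    have e3 : q.eval (k : ℝ) / avgBall G 2 = c := by rw [← e2]; field_simp
    have e4 : (PhiDen G θ s t / avgBall G 2) * (avgBall G 2 - Phi G θ s t) = 0 := by
      rw [← key0, e3]
      exact Finset.sum_eq_zero fun u _ => Finset.sum_eq_zero fun v _ => by rw [hc']; ring
    linarith [(mul_eq_zero.1 e4).resolve_left hpos.ne']

theorem eigMult_theta_zero (hconn : G.Connected) (hreg : G.IsRegularOfDegree k)
    (hθ : StrictAnti θ) (hspec : spectrum ℝ (G.adjMatrix ℝ) = Set.range θ) :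
    eigMult G (θ 0) = 1 := by
  rw [theta_zero_eq hconn hreg hθ hspec, eigMult_degree hconn hreg]

theorem trace_aeval_eq_add (hconn : G.Connected) (hreg : G.IsRegularOfDegree k)
    (hθ : StrictAnti θ) (hspec : spectrum ℝ (G.adjMatrix ℝ) = Set.range θ) (s : ℝ[X]) :
    (aeval (G.adjMatrix ℝ) s).trace = s.eval (θ 0) + sum₁ G θ s := by
  rw [trace_aeval_eq_sum_eigMult hθ hspec, Fin.sum_univ_succ,
    eigMult_theta_zero hconn hreg hθ hspec, Nat.cast_one, one_mul, sum₁]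

theorem tauDen_eq (hconn : G.Connected) (hreg : G.IsRegularOfDegree k)
    (hθ : StrictAnti θ) (hspec : spectrum ℝ (G.adjMatrix ℝ) = Set.range θ) (s : ℝ[X]) :
    tauDen G θ s = Fintype.card V * s.eval (θ 0) - (aeval (G.adjMatrix ℝ) s).trace := by
  rw [trace_aeval_eq_add hconn hreg hθ hspec, tauDen]
  ring

/-- The source of the formula for τ: it is the t at which s(A) - tI and s(A) - s(k)I are orthogonal.
The term of θ₀ drops out. -/
theorem trace_shift_mul_shift (hconn : G.Connected) (hreg : G.IsRegularOfDegree k)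
    (hθ : StrictAnti θ) (hspec : spectrum ℝ (G.adjMatrix ℝ) = Set.range θ) (s : ℝ[X]) (t : ℝ) :
    (aeval (G.adjMatrix ℝ) ((s - C t) * (s - C (s.eval (θ 0))))).trace =
      t * tauDen G θ s - (s.eval (θ 0) * sum₁ G θ s - sum₂ G θ s) := by
  have hsum : sum₂ G θ s + (s.eval (θ 0)) ^ 2 = (aeval (G.adjMatrix ℝ) (s ^ 2)).trace := by
    rw [trace_aeval_eq_add hconn hreg hθ hspec, sum₂, sum₁, eval_pow, add_comm]
    simp
  have h1 : (s - C t) * (s - C (s.eval (θ 0))) =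
      s ^ 2 - C (t + s.eval (θ 0)) * s + C (t * s.eval (θ 0)) := by
    rw [C_add, C_mul]; ring
  rw [h1, map_add, map_sub, ← smul_eq_C_mul, map_smul, aeval_C, Matrix.trace_add,
    Matrix.trace_sub, Matrix.trace_smul, ← hsum, trace_aeval_eq_add hconn hreg hθ hspec, tauDen,
    Algebra.algebraMap_eq_smul_one, Matrix.trace_smul, Matrix.trace_one]
  simp only [smul_eq_mul]
  ring

/-- If some shift of a quadratic in `A` is a multiple of the ball matrix, then the shift is `τ`. -/
theorem tau_eq_of_quadratic_eq_smul_ballMatrix (hconn : G.Connected)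
    (hreg : G.IsRegularOfDegree k) (hθ : StrictAnti θ)
    (hspec : spectrum ℝ (G.adjMatrix ℝ) = Set.range θ) {b e t c : ℝ}
    (hden : tauDen G θ (X ^ 2 - C b * X + C e) ≠ 0)
    (h : aeval (G.adjMatrix ℝ) (X ^ 2 - C b * X + C (e - t) : ℝ[X]) = c • ballMatrix G) :
    tau G θ (X ^ 2 - C b * X + C e) = t := by
  set s : ℝ[X] := X ^ 2 - C b * X + C e with hs
  have h0 : (aeval (G.adjMatrix ℝ) ((s - C t) * (s - C (s.eval (θ 0))))).trace = 0 := by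
    rw [mul_comm, map_mul, (G.isSymm_adjMatrix.aeval _).trace_mul_eq_sum, hs, quadratic_sub_C b e t,
      h]
    -- The shift by s(θ₀) makes the row sums zero, hence orthogonality to the ball matrix.
    have := sum_quadratic_mul_ballMatrix hconn hreg b (e - s.eval (θ 0))
    rw [← quadratic_sub_C, ← hs, eval_sub, eval_C, theta_zero_eq hconn hreg hθ hspec, sub_self,
      mul_zero] at this
    rw [← hs, theta_zero_eq hconn hreg hθ hspec]
    calc _ = c * ∑ u, ∑ v, aeval (G.adjMatrix ℝ) (s - C (s.eval (k : ℝ))) u v *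
          ballMatrix G u v := by
          simp only [Finset.mul_sum]
          refine Finset.sum_congr rfl fun u _ => Finset.sum_congr rfl fun v _ => ?_
          rw [Matrix.smul_apply, smul_eq_mul]; ring
      _ = 0 := by rw [this, mul_zero]
  rw [trace_shift_mul_shift hconn hreg hθ hspec] at h0
  rw [tau, div_eq_iff hden]
  linarith

theorem avgBall_eq_Phi_tau_iff (hconn : G.Connected) (hreg : G.IsRegularOfDegree k)
    (hθ : StrictAnti θ) (hspec : spectrum ℝ (G.adjMatrix ℝ) = Set.range θ) {b e : ℝ}
    (hden : tauDen G θ (X ^ 2 - C b * X + C e) ≠ 0) :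
    avgBall G 2 = Phi G θ (X ^ 2 - C b * X + C e) (tau G θ (X ^ 2 - C b * X + C e)) ↔
      ∃ d c : ℝ, G.adjMatrix ℝ ^ 2 - b • G.adjMatrix ℝ + d • (1 : Matrix V V ℝ) =
        c • ballMatrix G := by
  rw [(Phi_quadratic_le_avgBall hconn hreg hθ hspec b e _).2]
  constructor
  · rintro ⟨c, hc⟩
    exact ⟨_, c, by rw [← hc, aeval_quadratic]⟩
  · rintro ⟨d, c, hc⟩
    -- The shift t = e - d turns the constant term e into d; uniqueness of the shift then identifies
    -- t with τ.
    have h : aeval (G.adjMatrix ℝ) (X ^ 2 - C b * X + C (e - (e - d)) : ℝ[X]) =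
        c • ballMatrix G := by rw [aeval_quadratic, ← hc, sub_sub_cancel]
    refine ⟨c, ?_⟩
    rw [tau_eq_of_quadratic_eq_smul_ballMatrix hconn hreg hθ hspec hden h, h]

end Spectrum

/-! ### The predistance polynomials of degree at most 2, γ₂ and the denominator of τ. -/

section Predistance

variable {V : Type*} [Fintype V] [DecidableEq V] {G : SimpleGraph V} [DecidableRel G.Adj] {k : ℕ}

theorem trace_adjMatrix_sq (hreg : G.IsRegularOfDegree k) :
    (G.adjMatrix ℝ ^ 2).trace = Fintype.card V * k := by
  simp only [Matrix.trace, Matrix.diag, pow_two, SimpleGraph.adjMatrix_mul_self_apply_self]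
  simp [hreg.degree_eq]

/-- Summing A² over adjacent pairs gives at most its sum off the diagonal; its row sums are k² and
its diagonal entries k. -/
theorem trace_adjMatrix_cube_le (hreg : G.IsRegularOfDegree k) :
    (G.adjMatrix ℝ ^ 3).trace ≤ Fintype.card V * (k * (k - 1)) := by
  set A := G.adjMatrix ℝ with hA
  have hA0 : ∀ u v, 0 ≤ A u v := fun u v => by
    rw [hA, SimpleGraph.adjMatrix_apply]; split_ifs <;> norm_num
  have h1 : (A ^ 3).trace = ∑ u, ∑ w, (A ^ 2) u w * A u w := by
    rw [pow_succ, G.isSymm_adjMatrix.trace_mul_eq_sum]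
  have h2 : ∀ u w, (A ^ 2) u w * A u w ≤ (A ^ 2) u w - if u = w then (k : ℝ) else 0 := by
    intro u w
    have hnn : 0 ≤ (A ^ 2) u w := by
      rw [pow_two, Matrix.mul_apply]
      exact Finset.sum_nonneg fun v _ => mul_nonneg (hA0 _ _) (hA0 _ _)
    rcases eq_or_ne u w with rfl | h
    · have : (A ^ 2) u u = k := by
        rw [pow_two, SimpleGraph.adjMatrix_mul_self_apply_self, hreg.degree_eq]
      rw [this, hA, SimpleGraph.adjMatrix_apply]
      simp
    · rw [if_neg h, sub_zero]
      refine mul_le_of_le_one_right hnn ?_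
      rw [hA, SimpleGraph.adjMatrix_apply]; split_ifs <;> norm_num
  have h3 : ∀ u, ∑ w, (A ^ 2) u w = (k : ℝ) ^ 2 := fun u => by
    have := sum_aeval_adjMatrix_row hreg (X ^ 2 : ℝ[X]) u
    rwa [eval_pow, eval_X, map_pow, aeval_X] at this
  rw [h1]
  calc _ ≤ ∑ u, ∑ w, ((A ^ 2) u w - if u = w then (k : ℝ) else 0) :=
        Finset.sum_le_sum fun u _ => Finset.sum_le_sum fun w _ => h2 u w
    _ = Fintype.card V * (k * (k - 1)) := by
        simp only [Finset.sum_sub_distrib, h3, Finset.sum_ite_eq, Finset.mem_univ, if_true,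
          Finset.sum_const, Finset.card_univ, nsmul_eq_mul]
        ring

variable (G k) in
/-- The average number of triangles on an edge of a `k`-regular graph. -/
def triangleAvg : ℝ := (G.adjMatrix ℝ ^ 3).trace / (Fintype.card V * k)

theorem polyInner_eq_trace (p q : ℝ[X]) :
    polyInner G p q = (aeval (G.adjMatrix ℝ) (p * q)).trace / Fintype.card V := by
  rw [polyInner, map_mul]

theorem orthoPoly_zero : orthoPoly G 0 = 1 := by
  rw [orthoPoly]; simp

theorem orthoPoly_one : orthoPoly G 1 = X := by
  rw [orthoPoly]
  simp [orthoPoly_zero, polyInner]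

theorem polyInner_X_X [Nonempty V] (hreg : G.IsRegularOfDegree k) : polyInner G X X = k := by
  rw [polyInner_eq_trace, ← pow_two, map_pow, aeval_X, trace_adjMatrix_sq hreg]
  field_simp

theorem orthoPoly_two [Nonempty V] (hreg : G.IsRegularOfDegree k) :
    orthoPoly G 2 = X ^ 2 - C (triangleAvg G k) * X + C (-k : ℝ) := by
  have hn : (Fintype.card V : ℝ) ≠ 0 := by simp [Fintype.card_ne_zero]
  have h1 : polyInner G (1 : ℝ[X]) 1 = 1 := by
    simp [polyInner, hn]
  have h2 : polyInner G (X ^ 2) (1 : ℝ[X]) = k := by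
    rw [← polyInner_X_X hreg, polyInner_eq_trace, polyInner_eq_trace, mul_one, pow_two]
  have h3 : polyInner G (X ^ 2) (X : ℝ[X]) / k = triangleAvg G k := by
    rw [polyInner_eq_trace, ← pow_succ, map_pow, aeval_X, triangleAvg, div_div]
  rw [orthoPoly, Fin.sum_univ_two]
  simp only [Fin.val_zero, Fin.val_one, orthoPoly_zero, orthoPoly_one, polyInner_X_X hreg, h1, h2,
    h3, C_neg, div_one, mul_one]
  ring

theorem predistancePoly_zero [Nonempty V] : predistancePoly G k 0 = 1 := by
  simp [predistancePoly, orthoPoly_zero, polyInner]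

theorem predistancePoly_one [Nonempty V] (hreg : G.IsRegularOfDegree k) (hk : 0 < k) :
    predistancePoly G k 1 = X := by
  have : (k : ℝ) ≠ 0 := by exact_mod_cast hk.ne'
  simp [predistancePoly, orthoPoly_one, polyInner_X_X hreg, this]

theorem polyInner_orthoPoly_two_pos {θ : Fin 5 → ℝ} [Nonempty V] (hreg : G.IsRegularOfDegree k)
    (hθ : StrictAnti θ) (hspec : spectrum ℝ (G.adjMatrix ℝ) = Set.range θ) :
    0 < polyInner G (orthoPoly G 2) (orthoPoly G 2) := by
  have := PhiDen_quadratic_pos hθ hspec (triangleAvg G k) (-k) 0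
  rw [← trace_quadratic_mul_self hθ hspec, ← orthoPoly_two hreg, C_0, sub_zero] at this
  rw [polyInner_eq_trace]
  exact div_pos this (by simp [Fintype.card_pos])

/-- The difference of X² and the degree-2 polynomial lies in the span of 1 and X, to which that
polynomial is orthogonal. -/
theorem polyInner_X_sq_orthoPoly_two [Nonempty V] (hreg : G.IsRegularOfDegree k) (hk : 0 < k) :
    polyInner G (X ^ 2) (orthoPoly G 2) = polyInner G (orthoPoly G 2) (orthoPoly G 2) := by
  have hn : (Fintype.card V : ℝ) ≠ 0 := by simp [Fintype.card_ne_zero]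
  have hk' : (k : ℝ) ≠ 0 := by exact_mod_cast hk.ne'
  have h : (orthoPoly G 2) * (orthoPoly G 2) = X ^ 2 * orthoPoly G 2 -
      (triangleAvg G k • (X ^ 3 - triangleAvg G k • X ^ 2 - (k : ℝ) • X) +
        (k : ℝ) • (X ^ 2 - triangleAvg G k • X - (k : ℝ) • 1)) := by
    simp only [orthoPoly_two hreg, smul_eq_C_mul, C_neg]
    ring
  rw [polyInner_eq_trace, polyInner_eq_trace, h]
  simp only [map_sub, map_add, map_smul, map_pow, aeval_X, Matrix.trace_sub, Matrix.trace_add,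
    Matrix.trace_smul, map_one, Matrix.trace_one, trace_adjMatrix_sq hreg,
    SimpleGraph.trace_adjMatrix, smul_eq_mul]
  rw [show (G.adjMatrix ℝ ^ 3).trace = triangleAvg G k * (Fintype.card V * k) by
    rw [triangleAvg]; field_simp]
  congr 1
  ring

/-- With κ the normalizing factor and N the squared norm of the monic polynomial, the quotient is κN
/ (κ²N). If κ = 0, both sides are 0 by the convention for division by zero. -/
theorem preGamma_two {θ : Fin 5 → ℝ} [Nonempty V] (hreg : G.IsRegularOfDegree k)
    (hθ : StrictAnti θ) (hspec : spectrum ℝ (G.adjMatrix ℝ) = Set.range θ) :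
    preGamma G k 2 =
      ((orthoPoly G 2).eval (k : ℝ) / polyInner G (orthoPoly G 2) (orthoPoly G 2))⁻¹ := by
  have hk := degree_pos_of_spectrum hreg hθ hspec
  have hN := (polyInner_orthoPoly_two_pos hreg hθ hspec).ne'
  have hX := polyInner_X_sq_orthoPoly_two hreg hk
  rw [preGamma, predistancePoly_one hreg hk, ← pow_two, predistancePoly]
  set κ := (orthoPoly G 2).eval (k : ℝ) / polyInner G (orthoPoly G 2) (orthoPoly G 2)
  have h1 : ∀ p q : ℝ[X], polyInner G p (C κ * q) = κ * polyInner G p q := fun p q => by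
    rw [polyInner, polyInner, ← smul_eq_C_mul, map_smul, mul_smul_comm, Matrix.trace_smul,
      smul_eq_mul, mul_div_assoc]
  have h2 : ∀ p q : ℝ[X], polyInner G (C κ * p) q = κ * polyInner G p q := fun p q => by
    rw [polyInner, polyInner, ← smul_eq_C_mul, map_smul, smul_mul_assoc, Matrix.trace_smul,
      smul_eq_mul, mul_div_assoc]
  rw [h1, h1, h2, hX]
  rcases eq_or_ne κ 0 with h | h
  · simp [h]
  · field_simp

theorem orthoPoly_two_eval_nonneg [Nonempty V] (hreg : G.IsRegularOfDegree k) (hk : 0 < k) :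
    0 ≤ (orthoPoly G 2).eval (k : ℝ) := by
  have hn : (0 : ℝ) < Fintype.card V := by simp [Fintype.card_pos]
  have hk' : (0 : ℝ) < k := by exact_mod_cast hk
  have h : triangleAvg G k ≤ k - 1 := by
    rw [triangleAvg, div_le_iff₀ (by positivity)]
    linarith [trace_adjMatrix_cube_le hreg]
  rw [orthoPoly_two hreg]
  simp only [eval_add, eval_sub, eval_mul, eval_C, eval_X, eval_pow]
  nlinarith

theorem preGamma_two_nonneg {θ : Fin 5 → ℝ} [Nonempty V] (hreg : G.IsRegularOfDegree k)
    (hθ : StrictAnti θ) (hspec : spectrum ℝ (G.adjMatrix ℝ) = Set.range θ) :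
    0 ≤ preGamma G k 2 := by
  rw [preGamma_two hreg hθ hspec]
  exact inv_nonneg.2 (div_nonneg
    (orthoPoly_two_eval_nonneg hreg (degree_pos_of_spectrum hreg hθ hspec))
    (polyInner_orthoPoly_two_pos hreg hθ hspec).le)

/-- As tr A = 0 and tr A² = nk, the denominator is nk(k - 1 - b), which is positive because θ₁ < k
and θ₄ ≤ -1. -/
theorem tauDen_quadratic_ne_zero {θ : Fin 5 → ℝ} (hconn : G.Connected)
    (hreg : G.IsRegularOfDegree k) (hθ : StrictAnti θ)
    (hspec : spectrum ℝ (G.adjMatrix ℝ) = Set.range θ) {b : ℝ} (hb : b ≤ θ 1 + θ 4) (e : ℝ) :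
    tauDen G θ (X ^ 2 - C b * X + C e) ≠ 0 := by
  have := hconn.nonempty
  have hk := degree_pos_of_spectrum hreg hθ hspec
  obtain ⟨u, v, huv⟩ := exists_adj_of_degree_pos hreg hk
  have h4 := theta_four_le hθ hspec huv
  have h0 := theta_zero_eq hconn hreg hθ hspec
  have h1 := hθ (show (0 : Fin 5) < 1 by decide)
  have hn : (0 : ℝ) < Fintype.card V := by simp [Fintype.card_pos]
  have hk' : (0 : ℝ) < k := by exact_mod_cast hk
  have h : tauDen G θ (X ^ 2 - C b * X + C e) = Fintype.card V * (k * (k - 1 - b)) := by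
    rw [tauDen_eq hconn hreg hθ hspec, h0, aeval_quadratic, Matrix.trace_add, Matrix.trace_sub,
      Matrix.trace_smul, Matrix.trace_smul, trace_adjMatrix_sq hreg, Matrix.trace_one,
      SimpleGraph.trace_adjMatrix]
    simp only [eval_add, eval_sub, eval_mul, eval_C, eval_X, eval_pow, smul_eq_mul]
    ring
  have h2 : 0 < (k : ℝ) - 1 - b := by linarith
  rw [h]
  positivity

end Predistance

/-! ### Strong regularity as a quadratic matrix equation. -/

section StronglyRegular

variable {V : Type*} [Fintype V]

theorem adjMatrix_mul_self_apply (H : SimpleGraph V) [DecidableEq V] [DecidableRel H.Adj] (u v : V) :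
    (H.adjMatrix ℝ * H.adjMatrix ℝ) u v = (Fintype.card (H.commonNeighbors u v) : ℝ) := by
  rw [Matrix.mul_apply]
  simp only [SimpleGraph.adjMatrix_apply, mul_ite, mul_one, mul_zero, ← ite_and]
  rw [Finset.sum_boole, ← Set.toFinset_card]
  congr 2
  ext w
  simp [SimpleGraph.mem_commonNeighbors, H.adj_comm v w, and_comm]

theorem isStronglyRegular_of_adjMatrix_mul_self [DecidableEq V] {H : SimpleGraph V}
    [DecidableRel H.Adj] (htop : H ≠ ⊤) (hbot : H ≠ ⊥) {p q z : ℝ}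
    (h : ∀ u v, (H.adjMatrix ℝ * H.adjMatrix ℝ) u v =
      p * H.adjMatrix ℝ u v + (if u = v then q else 0) + z) : IsStronglyRegular H := by
  have hdeg : ∀ u, (H.degree u : ℝ) = q + z := fun u => by
    rw [← SimpleGraph.adjMatrix_mul_self_apply_self, h]
    simp
  have hadj : ∀ u v, H.Adj u v → (Fintype.card (H.commonNeighbors u v) : ℝ) = p + z :=
    fun u v huv => by
      rw [← adjMatrix_mul_self_apply, h]
      simp [huv, huv.ne]
  have hnot : ∀ u v, u ≠ v → ¬ H.Adj u v → (Fintype.card (H.commonNeighbors u v) : ℝ) = z :=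
    fun u v hne huv => by
      rw [← adjMatrix_mul_self_apply, h]
      simp [huv, hne]
  obtain ⟨a, b, hab⟩ := SimpleGraph.ne_bot_iff_exists_adj.1 hbot
  obtain ⟨c, d, hcd, hncd⟩ := SimpleGraph.ne_top_iff_exists_not_adj.1 htop
  have hs : H.IsSRGWith (Fintype.card V) (H.degree a) (Fintype.card (H.commonNeighbors a b))
      (Fintype.card (H.commonNeighbors c d)) :=
    { card := rfl
      regular := fun u => by
        have := (hdeg u).trans (hdeg a).symm
        exact_mod_cast this
      of_adj := fun u v huv => by
        have := (hadj u v huv).trans (hadj a b hab).symm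
        exact_mod_cast this
      of_not_adj := fun u v hne huv => by
        have := (hnot u v hne huv).trans (hnot c d hcd hncd).symm
        exact_mod_cast this }
  exact ⟨htop, hbot, _, _, _, by convert hs⟩

theorem IsStronglyRegular.exists_mul_self [DecidableEq V] {H : SimpleGraph V}
    [DecidableRel H.Adj] (h : IsStronglyRegular H) :
    ∃ p q z : ℝ, ∀ u v, (H.adjMatrix ℝ * H.adjMatrix ℝ) u v =
      p * H.adjMatrix ℝ u v + (if u = v then q else 0) + z := by
  obtain ⟨-, -, d, l, m, hs'⟩ := h
  have hs : H.IsSRGWith (Fintype.card V) d l m := by convert hs'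
  refine ⟨l - m, d - m, m, fun u v => ?_⟩
  rcases eq_or_ne u v with rfl | hne
  · rw [SimpleGraph.adjMatrix_mul_self_apply_self, hs.regular.degree_eq]
    simp
  · rw [adjMatrix_mul_self_apply]
    by_cases huv : H.Adj u v
    · rw [hs.of_adj u v huv]
      simp [huv, hne]
    · rw [hs.of_not_adj hne huv]
      simp [huv, hne]

end StronglyRegular

/-! ### Which quadratics in A can be adjacency matrices of strongly regular graphs. -/

section Characterization

variable {V : Type*} [Fintype V] [DecidableEq V] {G H : SimpleGraph V} [DecidableRel G.Adj]
  [DecidableRel H.Adj] {k : ℕ} {θ : Fin 5 → ℝ}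

theorem exists_sum_zero_eigenvector (hconn : G.Connected) (hreg : G.IsRegularOfDegree k)
    (hθ : StrictAnti θ) (hspec : spectrum ℝ (G.adjMatrix ℝ) = Set.range θ) {i : Fin 5}
    (hi : i ≠ 0) :
    ∃ x : V → ℝ, x ≠ 0 ∧ (G.adjMatrix ℝ).mulVec x = θ i • x ∧ ∑ v, x v = 0 := by
  obtain ⟨x, hx, h⟩ := Matrix.exists_eigenvector_of_mem_spectrum
    (hspec ▸ Set.mem_range_self i : θ i ∈ spectrum ℝ (G.adjMatrix ℝ))
  refine ⟨x, hx, h, sum_eigenvector_eq_zero hreg h ?_⟩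
  rw [← theta_zero_eq hconn hreg hθ hspec]
  exact hθ.injective.ne hi

/-- If `p(A)` is constant off the diagonal and on the diagonal, then `p` is constant on
the nontrivial eigenvalues. -/
theorem eval_theta_of_aeval_apply (hconn : G.Connected) (hreg : G.IsRegularOfDegree k)
    (hθ : StrictAnti θ) (hspec : spectrum ℝ (G.adjMatrix ℝ) = Set.range θ) {p : ℝ[X]} {q z : ℝ}
    (h : ∀ u v, aeval (G.adjMatrix ℝ) p u v = (if u = v then q else 0) + z) {i : Fin 5}
    (hi : i ≠ 0) : p.eval (θ i) = q := by
  obtain ⟨x, hx, hAx, hs⟩ := exists_sum_zero_eigenvector hconn hreg hθ hspec hi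
  have h1 := Matrix.aeval_mulVec_of_eigenvector hAx p
  have h2 : (aeval (G.adjMatrix ℝ) p).mulVec x = q • x := by
    ext u
    simp only [Matrix.mulVec, dotProduct, h, add_mul, Finset.sum_add_distrib, ← Finset.mul_sum, hs,
      ite_mul, zero_mul, Finset.sum_ite_eq, Finset.mem_univ, if_true, mul_zero, add_zero,
      Pi.smul_apply, smul_eq_mul]
  exact smul_left_injective ℝ hx (h1.symm.trans h2)

theorem isStronglyRegular_of_quadratic (hconn : G.Connected) (hreg : G.IsRegularOfDegree k)
    (hθ : StrictAnti θ) (hspec : spectrum ℝ (G.adjMatrix ℝ) = Set.range θ)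
    (hsum : θ 1 + θ 4 = θ 2 + θ 3) {c e : ℝ} (hc : c ≠ 0)
    (h : c • H.adjMatrix ℝ =
      aeval (G.adjMatrix ℝ) (X ^ 2 - C (θ 1 + θ 4) * X + C e : ℝ[X])) :
    IsStronglyRegular H := by
  have := hconn.nonempty
  set f : ℝ[X] := X ^ 2 - C (θ 1 + θ 4) * X + C e with hf
  have hev : ∀ t, f.eval t = t ^ 2 - (θ 1 + θ 4) * t + e := fun t => by simp [hf]
  have h12 := hθ (show (1 : Fin 5) < 2 by decide)
  have h24 := hθ (show (2 : Fin 5) < 4 by decide)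
  have hne : f.eval (θ 1) ≠ f.eval (θ 2) := by
    rw [hev, hev]
    intro heq
    have : (θ 1 - θ 2) * (θ 2 - θ 4) = 0 := by linear_combination heq
    exact (mul_pos (sub_pos.2 h12) (sub_pos.2 h24)).ne' this
  -- A complete or edgeless H would make f(A) a combination of I and the all-ones matrix, hence f
  -- constant on the nontrivial eigenvalues.
  have hconst : ∀ q z : ℝ, ¬ ∀ u v, aeval (G.adjMatrix ℝ) f u v = (if u = v then q else 0) + z :=
    fun q z h' => hne <|
      (eval_theta_of_aeval_apply hconn hreg hθ hspec h' (by decide : (1 : Fin 5) ≠ 0)).trans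
        (eval_theta_of_aeval_apply hconn hreg hθ hspec h' (by decide : (2 : Fin 5) ≠ 0)).symm
  have htop : H ≠ ⊤ := by
    rintro rfl
    refine hconst (-c) c fun u v => ?_
    rw [← h, Matrix.smul_apply, SimpleGraph.adjMatrix_apply]
    by_cases huv : u = v <;> simp [huv]
  have hbot : H ≠ ⊥ := by
    rintro rfl
    refine hconst 0 0 fun u v => ?_
    rw [← h, Matrix.smul_apply, SimpleGraph.adjMatrix_apply]
    simp
  set x := f.eval (θ 1) with hx
  set y := f.eval (θ 2) with hy
  -- (f - x)(f - y) vanishes at every nontrivial eigenvalue because f is symmetric under exchanging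
  -- θ₁ with θ₄ and θ₂ with θ₃.
  obtain ⟨z, hz⟩ := aeval_adjMatrix_const hconn hreg hθ hspec
    (p := f * f - C (x + y) * f + C (x * y)) (by
      intro i hi
      have h4 : f.eval (θ 4) = x := by rw [hx, hev, hev]; ring
      have h3 : f.eval (θ 3) = y := by rw [hy, hev, hev, hsum]; ring
      have : f.eval (θ i) = x ∨ f.eval (θ i) = y := by
        fin_cases i
        · exact absurd rfl hi
        · exact Or.inl rfl
        · exact Or.inr rfl
        · exact Or.inr h3
        · exact Or.inl h4
      simp only [eval_add, eval_sub, eval_mul, eval_C]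
      rcases this with h' | h' <;> rw [h'] <;> ring)
  refine isStronglyRegular_of_adjMatrix_mul_self htop hbot (p := (x + y) / c)
    (q := -(x * y) / c ^ 2) (z := z / c ^ 2) fun u v => ?_
  have := hz u v
  rw [map_add, map_sub, map_mul, ← smul_eq_C_mul, map_smul, aeval_C, ← h,
    Algebra.algebraMap_eq_smul_one, smul_mul_smul_comm] at this
  simp only [Matrix.add_apply, Matrix.sub_apply, Matrix.smul_apply, smul_eq_mul,
    Matrix.one_apply] at this
  have e1 : ∀ w : ℝ, (if u = v then w else 0) = w * if u = v then 1 else 0 := fun w => by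
    split_ifs <;> simp
  rw [e1]
  field_simp
  linear_combination this

/-- θ₁ + θ₂ > θ₁ + θ₃ > θ₂ + θ₃ > θ₂ + θ₄ > θ₃ + θ₄, so the two lists share only θ₂ + θ₃. -/
theorem lin_coeff_of_two_values (hθ : StrictAnti θ) (hsum : θ 1 + θ 4 = θ 2 + θ 3) {m : ℝ}
    (h1 : m = θ 1 + θ 2 ∨ m = θ 1 + θ 3 ∨ m = θ 2 + θ 3)
    (h2 : m = θ 2 + θ 3 ∨ m = θ 2 + θ 4 ∨ m = θ 3 + θ 4) : m = θ 1 + θ 4 := by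
  have h12 := hθ (show (1 : Fin 5) < 2 by decide)
  have h23 := hθ (show (2 : Fin 5) < 3 by decide)
  have h34 := hθ (show (3 : Fin 5) < 4 by decide)
  rcases h1 with h1 | h1 | h1 <;> rcases h2 with h2 | h2 | h2 <;> linarith

theorem two_eq_of_quadratic {a b c r s : ℝ} (ha : a ^ 2 = r * a + s) (hb : b ^ 2 = r * b + s)
    (hc : c ^ 2 = r * c + s) : a = b ∨ a = c ∨ b = c := by
  by_cases hab : a = b
  · exact Or.inl hab
  by_cases hac : a = c
  · exact Or.inr (Or.inl hac)
  have e1 : (a - b) * (a + b - r) = 0 := by linear_combination ha - hb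
  have e2 : (a - c) * (a + c - r) = 0 := by linear_combination ha - hc
  have e1 := (mul_eq_zero.1 e1).resolve_left (sub_ne_zero.2 hab)
  have e2 := (mul_eq_zero.1 e2).resolve_left (sub_ne_zero.2 hac)
  exact Or.inr (Or.inr (by linarith))

/-- A strongly regular graph whose adjacency matrix is a quadratic polynomial in `A`
forces the parabola to be symmetric about `(θ₁ + θ₄) / 2`. -/
theorem coeff_of_isStronglyRegular (hconn : G.Connected) (hreg : G.IsRegularOfDegree k)
    (hθ : StrictAnti θ) (hspec : spectrum ℝ (G.adjMatrix ℝ) = Set.range θ)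
    (hsum : θ 1 + θ 4 = θ 2 + θ 3) {r s t : ℝ} (hH : IsStronglyRegular H)
    (h : H.adjMatrix ℝ = aeval (G.adjMatrix ℝ) (C r * X ^ 2 - C s * X + C t : ℝ[X])) :
    r ≠ 0 ∧ s = r * (θ 1 + θ 4) ∨ r = 0 ∧ s = 0 := by
  set g : ℝ[X] := C r * X ^ 2 - C s * X + C t with hg
  have hev : ∀ x, g.eval x = r * x ^ 2 - s * x + t := fun x => by simp [hg]
  obtain ⟨p, q, z, hpq⟩ := hH.exists_mul_self
  have hquad : ∀ i : Fin 5, i ≠ 0 → (g.eval (θ i)) ^ 2 = p * g.eval (θ i) + q := by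
    intro i hi
    have := eval_theta_of_aeval_apply hconn hreg hθ hspec (p := g * g - C p * g) (q := q) (z := z)
      (fun u v => by
        rw [map_sub, map_mul, ← smul_eq_C_mul, map_smul, ← h, Matrix.sub_apply,
          Matrix.smul_apply, smul_eq_mul]
        rw [hpq u v]; ring) hi
    simp only [eval_sub, eval_mul, eval_C] at this
    linear_combination this
  have hpair : ∀ i j, i < j → g.eval (θ i) = g.eval (θ j) → r * (θ i + θ j) = s := by
    intro i j hij heq
    rw [hev, hev] at heq
    have : (θ i - θ j) * (r * (θ i + θ j) - s) = 0 := by linear_combination heq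
    have := (mul_eq_zero.1 this).resolve_left (sub_ne_zero.2 (hθ hij).ne')
    linarith
  -- At most two values occur, so g repeats a value among θ₁, θ₂, θ₃ and again among θ₂, θ₃, θ₄;
  -- each repetition locates the axis of the parabola.
  have t1 := two_eq_of_quadratic (hquad 1 (by decide)) (hquad 2 (by decide)) (hquad 3 (by decide))
  have t2 := two_eq_of_quadratic (hquad 2 (by decide)) (hquad 3 (by decide)) (hquad 4 (by decide))
  have t1 := t1.imp (hpair 1 2 (by decide)) (Or.imp (hpair 1 3 (by decide)) (hpair 2 3 (by decide)))
  have t2 := t2.imp (hpair 2 3 (by decide)) (Or.imp (hpair 2 4 (by decide)) (hpair 3 4 (by decide)))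
  by_cases hr : r = 0
  · subst hr
    simp only [zero_mul] at t1
    exact Or.inr ⟨rfl, by rcases t1 with h | h | h <;> exact h.symm⟩
  · left
    refine ⟨hr, ?_⟩
    have hdiv : ∀ a, r * a = s → s / r = a := fun a ha => by rw [← ha]; field_simp
    rw [← lin_coeff_of_two_values hθ hsum (t1.imp (hdiv _) (Or.imp (hdiv _) (hdiv _)))
      (t2.imp (hdiv _) (Or.imp (hdiv _) (hdiv _)))]
    field_simp

end Characterization

/-! ### The two distance graphs as A₂ + εA. -/

section DistanceGraph

variable {V : Type*} [DecidableEq V] {G : SimpleGraph V} [DecidableRel G.Adj]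

theorem adjMatrix_distanceGraph_two [DecidableRel (distanceGraph G {2}).Adj] :
    (distanceGraph G {2}).adjMatrix ℝ = distanceMatrix G 2 + (0 : ℝ) • G.adjMatrix ℝ := by
  ext u v
  by_cases h : u = v
  · subst h; simp [distanceMatrix]
  · simp [distanceGraph, distanceMatrix, h]

theorem adjMatrix_distanceGraph_one_two [DecidableRel (distanceGraph G {1, 2}).Adj] :
    (distanceGraph G {1, 2}).adjMatrix ℝ = distanceMatrix G 2 + (1 : ℝ) • G.adjMatrix ℝ := by
  ext u v
  by_cases h : u = v
  · subst h; simp [distanceMatrix]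
  · rcases h2 : G.dist u v with _ | _ | _ | d <;>
      simp [distanceGraph, distanceMatrix, ← SimpleGraph.dist_eq_one_iff_adj, h, h2]

end DistanceGraph

/-! ### The equality case. -/

section Equality

variable {V : Type*} [Fintype V] [DecidableEq V] {G H : SimpleGraph V} [DecidableRel G.Adj]
  [DecidableRel H.Adj] {k : ℕ} {θ : Fin 5 → ℝ}

theorem orthoPoly_two_aeval_of_quadratic [Nonempty V] (hreg : G.IsRegularOfDegree k) (hk : 0 < k)
    (hconn : G.Connected) {b d c : ℝ}
    (h : G.adjMatrix ℝ ^ 2 - b • G.adjMatrix ℝ + d • (1 : Matrix V V ℝ) = c • ballMatrix G) :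
    triangleAvg G k = b + c ∧
      aeval (G.adjMatrix ℝ) (orthoPoly G 2) = c • distanceMatrix G 2 := by
  have hn : (Fintype.card V : ℝ) ≠ 0 := by simp [Fintype.card_ne_zero]
  have hk' : (k : ℝ) ≠ 0 := by exact_mod_cast hk.ne'
  -- Diagonal entries fix d; below, the trace against A fixes the mean triangle count, since A₂ and
  -- A have disjoint supports.
  have hdiag : (k : ℝ) + d = c := by
    let u : V := Classical.arbitrary V
    have := congrFun (congrFun h u) u
    simpa only [Matrix.add_apply, Matrix.sub_apply, Matrix.smul_apply, pow_two,
      SimpleGraph.adjMatrix_mul_self_apply_self, hreg.degree_eq, SimpleGraph.adjMatrix_apply,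
      SimpleGraph.irrefl, if_false, smul_zero, sub_zero, Matrix.one_apply_eq, smul_eq_mul, mul_one,
      mul_zero, ballMatrix_apply, SimpleGraph.dist_self, zero_le, if_true] using this
  have hsq : G.adjMatrix ℝ ^ 2 = (b + c) • G.adjMatrix ℝ + (k : ℝ) • (1 : Matrix V V ℝ) +
      c • distanceMatrix G 2 := by
    rw [ballMatrix, distanceMatrix_zero hconn, distanceMatrix_one, ← hdiag] at h
    rw [← hdiag]
    rw [← sub_eq_zero] at h ⊢
    rw [← h]
    module
  have htr : (distanceMatrix G 2 * G.adjMatrix ℝ).trace = 0 := by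
    rw [G.isSymm_adjMatrix.trace_mul_eq_sum]
    refine Finset.sum_eq_zero fun u _ => Finset.sum_eq_zero fun v _ => ?_
    rw [← distanceMatrix_one]
    simp only [distanceMatrix, Matrix.of_apply]
    split_ifs with h1 h2 <;> first | omega | simp
  have htri : triangleAvg G k = b + c := by
    rw [triangleAvg, pow_succ, hsq, add_mul, add_mul, smul_mul_assoc, smul_mul_assoc,
      smul_mul_assoc, one_mul, ← pow_two, Matrix.trace_add, Matrix.trace_add, Matrix.trace_smul,
      Matrix.trace_smul, Matrix.trace_smul, htr, SimpleGraph.trace_adjMatrix,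
      trace_adjMatrix_sq hreg, smul_zero, smul_zero, add_zero, add_zero, smul_eq_mul]
    field_simp
  refine ⟨htri, ?_⟩
  rw [orthoPoly_two hreg, aeval_quadratic, hsq, htri, neg_smul]
  abel

/-- Every entry x of the given matrix satisfies x² = cx, so averaging row sums gives N = c·o(k),
where o is the monic degree-2 polynomial and N > 0 its squared norm. Hence c ≠ 0 and the normalizing
factor is 1/c. -/
theorem isPartiallyDistanceRegular_of_orthoPoly_two (hreg : G.IsRegularOfDegree k)
    (hconn : G.Connected) (hθ : StrictAnti θ)
    (hspec : spectrum ℝ (G.adjMatrix ℝ) = Set.range θ) {c : ℝ}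
    (h : aeval (G.adjMatrix ℝ) (orthoPoly G 2) = c • distanceMatrix G 2) :
    c ≠ 0 ∧ preGamma G k 2 = c ∧ IsPartiallyDistanceRegular G k 2 := by
  have := hconn.nonempty
  have hn : (Fintype.card V : ℝ) ≠ 0 := by simp [Fintype.card_ne_zero]
  have hk := degree_pos_of_spectrum hreg hθ hspec
  have hN := polyInner_orthoPoly_two_pos hreg hθ hspec
  set N := polyInner G (orthoPoly G 2) (orthoPoly G 2) with hNdef
  have hentry : ∀ u v, aeval (G.adjMatrix ℝ) (orthoPoly G 2) u v *
      aeval (G.adjMatrix ℝ) (orthoPoly G 2) u v =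
        c * aeval (G.adjMatrix ℝ) (orthoPoly G 2) u v := fun u v => by
    rw [h]
    simp only [distanceMatrix, Matrix.smul_apply, Matrix.of_apply, smul_eq_mul]
    split_ifs <;> ring
  have hNc : N = c * (orthoPoly G 2).eval (k : ℝ) := by
    rw [hNdef, polyInner, (G.isSymm_adjMatrix.aeval _).trace_mul_eq_sum, div_eq_iff hn]
    simp_rw [hentry, ← Finset.mul_sum, sum_aeval_adjMatrix_row hreg]
    rw [Finset.sum_const, Finset.card_univ, nsmul_eq_mul]
    ring
  have hc : c ≠ 0 := by
    rintro rfl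
    rw [zero_mul] at hNc
    exact hN.ne' hNc
  have hev : (orthoPoly G 2).eval (k : ℝ) ≠ 0 := by
    intro h0
    rw [h0, mul_zero] at hNc
    exact hN.ne' hNc
  have hκ : (orthoPoly G 2).eval (k : ℝ) / N = c⁻¹ := by
    rw [hNc]; field_simp
  refine ⟨hc, by rw [preGamma_two hreg hθ hspec, ← hNdef, hκ, inv_inv], ?_, ?_⟩
  · have hex : ∃ u v, G.dist u v = 2 := by
      by_contra! hne
      have h0 : aeval (G.adjMatrix ℝ) (orthoPoly G 2) = 0 := by
        rw [h]
        ext u v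
        simp [distanceMatrix, hne u v]
      rw [hNdef, polyInner, h0, zero_mul, Matrix.trace_zero, zero_div] at hN
      exact lt_irrefl _ hN
    obtain ⟨u, v, huv⟩ := hex
    rw [← huv]
    exact SimpleGraph.dist_le_diam (SimpleGraph.connected_iff_ediam_ne_top.1 hconn)
  · intro i hi
    interval_cases i
    · rw [predistancePoly_zero, map_one, distanceMatrix_zero hconn]
    · rw [predistancePoly_one hreg hk, aeval_X, distanceMatrix_one]
    · rw [predistancePoly, ← hNdef, hκ, ← smul_eq_C_mul, map_smul, h, smul_smul,
        inv_mul_cancel₀ hc, one_smul]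

theorem exists_quadratic_eq_smul_ballMatrix_iff (hconn : G.Connected)
    (hreg : G.IsRegularOfDegree k) (hθ : StrictAnti θ)
    (hspec : spectrum ℝ (G.adjMatrix ℝ) = Set.range θ) (hsum : θ 1 + θ 4 = θ 2 + θ 3) {ε b : ℝ}
    (hb : b = θ 1 + θ 4 - (1 - ε) * preGamma G k 2)
    (hH : H.adjMatrix ℝ = distanceMatrix G 2 + ε • G.adjMatrix ℝ) :
    (∃ d c : ℝ, G.adjMatrix ℝ ^ 2 - b • G.adjMatrix ℝ + d • (1 : Matrix V V ℝ) =
        c • ballMatrix G) ↔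
      IsPartiallyDistanceRegular G k 2 ∧ IsStronglyRegular H := by
  have := hconn.nonempty
  have hk := degree_pos_of_spectrum hreg hθ hspec
  constructor
  · rintro ⟨d, c, h⟩
    obtain ⟨htri, ho⟩ := orthoPoly_two_aeval_of_quadratic hreg hk hconn h
    obtain ⟨hc, hγ, hP⟩ := isPartiallyDistanceRegular_of_orthoPoly_two hreg hconn hθ hspec ho
    -- The mean triangle count is b + c = θ₁ + θ₄ + εc; adding εcA to cA₂ cancels the excess εc in
    -- the linear term.
    refine ⟨hP, isStronglyRegular_of_quadratic hconn hreg hθ hspec hsum (e := -k) hc ?_⟩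
    rw [hH, smul_add, ← ho, orthoPoly_two hreg, aeval_quadratic, aeval_quadratic, htri, hb, hγ]
    module
  · rintro ⟨hP, hS⟩
    have hp2 := hP.2 2 le_rfl
    rw [predistancePoly] at hp2
    have hγ := preGamma_two hreg hθ hspec
    set κ := (orthoPoly G 2).eval (k : ℝ) / polyInner G (orthoPoly G 2) (orthoPoly G 2)
    rw [orthoPoly_two hreg, ← smul_eq_C_mul, map_smul, aeval_quadratic] at hp2
    clear_value κ
    have hX : H.adjMatrix ℝ = aeval (G.adjMatrix ℝ)
        (C κ * X ^ 2 - C (κ * triangleAvg G k - ε) * X + C (-(κ * k)) : ℝ[X]) := by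
      rw [hH, ← hp2]
      rw [map_add, map_sub, ← smul_eq_C_mul, ← smul_eq_C_mul, map_smul, map_smul, map_pow, aeval_X,
        aeval_C, Algebra.algebraMap_eq_smul_one]
      module
    rcases coeff_of_isStronglyRegular hconn hreg hθ hspec hsum hS hX with ⟨hκ, hco⟩ | ⟨hκ, hco⟩
    -- Here c = γ₂ = 1/κ, and d = c - k is forced by the diagonal.
    · refine ⟨κ⁻¹ - k, κ⁻¹, ?_⟩
      have htri : triangleAvg G k = θ 1 + θ 4 + ε * κ⁻¹ := by
        field_simp
        linear_combination hco
      rw [ballMatrix, distanceMatrix_zero hconn, distanceMatrix_one, smul_add, ← hp2, smul_smul,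
        inv_mul_cancel₀ hκ, one_smul, hb, hγ, htri]
      module
    -- κ = 0 gives A₂ = 0, and the vanishing linear coefficient gives ε = 0, so H would have no
    -- edges.
    · exfalso
      have hε0 : ε = 0 := by rw [hκ] at hco; linarith
      refine hS.2.1 ?_
      by_contra hne
      obtain ⟨u, v, huv⟩ := SimpleGraph.ne_bot_iff_exists_adj.1 hne
      rw [hκ, zero_smul] at hp2
      rw [← hp2, hε0, zero_smul, add_zero] at hH
      have := congrFun (congrFun hH u) v
      simp [huv] at this

/-- The bound and its equality case for `X² - b X + e`, where `b = θ₁ + θ₄ - (1 - ε) γ₂`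
and `H` is the graph with adjacency matrix `A₂ + ε A`. -/
theorem avgBall_bound_of_quadratic (hconn : G.Connected)
    (hreg : G.IsRegularOfDegree k) (hθ : StrictAnti θ)
    (hspec : spectrum ℝ (G.adjMatrix ℝ) = Set.range θ) (hsum : θ 1 + θ 4 = θ 2 + θ 3) {ε b : ℝ}
    (hε : ε = 0 ∨ ε = 1) (hb : b = θ 1 + θ 4 - (1 - ε) * preGamma G k 2)
    (hH : H.adjMatrix ℝ = distanceMatrix G 2 + ε • G.adjMatrix ℝ) {s : ℝ[X]} {e : ℝ}
    (hs : s = X ^ 2 - C b * X + C e) :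
    tauDen G θ s ≠ 0 ∧ PhiDen G θ s (tau G θ s) ≠ 0 ∧ Phi G θ s (tau G θ s) ≤ avgBall G 2 ∧
      (avgBall G 2 = Phi G θ s (tau G θ s) ↔
        IsPartiallyDistanceRegular G k 2 ∧ IsStronglyRegular H) := by
  have := hconn.nonempty
  have hγ := preGamma_two_nonneg hreg hθ hspec
  have hden : tauDen G θ s ≠ 0 := by
    rw [hs]
    refine tauDen_quadratic_ne_zero hconn hreg hθ hspec ?_ e
    rw [hb]
    -- For ε = 0 the inequality needed is γ₂ ≥ 0.
    rcases hε with rfl | rfl <;> linarith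
  subst hs
  exact ⟨hden, (PhiDen_quadratic_pos hθ hspec b e _).ne',
    (Phi_quadratic_le_avgBall hconn hreg hθ hspec b e _).1,
    (avgBall_eq_Phi_tau_iff hconn hreg hθ hspec hden).trans
      (exists_quadratic_eq_smul_ballMatrix_iff hconn hreg hθ hspec hsum hb hH)⟩

end Equality

end SpectralExcess

end

theorem mainTheorem3 {V : Type*} [Fintype V] [DecidableEq V] (G : SimpleGraph V)
    [DecidableRel G.Adj] (k : ℕ) (hconn : G.Connected) (hreg : G.IsRegularOfDegree k)
    (θ : Fin 5 → ℝ) (hθ : StrictAnti θ)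
    (hspec : spectrum ℝ (G.adjMatrix ℝ) = Set.range θ)
    (hsum : θ 1 + θ 4 = θ 2 + θ 3) :
    (SpectralExcess.tauDen G θ (SpectralExcess.s₁ G k θ) ≠ 0 ∧
      SpectralExcess.PhiDen G θ (SpectralExcess.s₁ G k θ)
        (SpectralExcess.tau G θ (SpectralExcess.s₁ G k θ)) ≠ 0 ∧
      SpectralExcess.Phi G θ (SpectralExcess.s₁ G k θ)
        (SpectralExcess.tau G θ (SpectralExcess.s₁ G k θ)) ≤ SpectralExcess.avgBall G 2 ∧
      (SpectralExcess.avgBall G 2 = SpectralExcess.Phi G θ (SpectralExcess.s₁ G k θ)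
          (SpectralExcess.tau G θ (SpectralExcess.s₁ G k θ)) ↔
        SpectralExcess.IsPartiallyDistanceRegular G k 2 ∧
          SpectralExcess.IsStronglyRegular (SpectralExcess.distanceGraph G {2}))) ∧
    (SpectralExcess.tauDen G θ (SpectralExcess.s₂ G k θ) ≠ 0 ∧
      SpectralExcess.PhiDen G θ (SpectralExcess.s₂ G k θ)
        (SpectralExcess.tau G θ (SpectralExcess.s₂ G k θ)) ≠ 0 ∧
      SpectralExcess.Phi G θ (SpectralExcess.s₂ G k θ)
        (SpectralExcess.tau G θ (SpectralExcess.s₂ G k θ)) ≤ SpectralExcess.avgBall G 2 ∧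
      (SpectralExcess.avgBall G 2 = SpectralExcess.Phi G θ (SpectralExcess.s₂ G k θ)
          (SpectralExcess.tau G θ (SpectralExcess.s₂ G k θ)) ↔
        SpectralExcess.IsPartiallyDistanceRegular G k 2 ∧
          SpectralExcess.IsStronglyRegular (SpectralExcess.distanceGraph G {1, 2}))) := by
  classical
  exact ⟨SpectralExcess.avgBall_bound_of_quadratic hconn hreg hθ hspec hsum (ε := 0) (Or.inl rfl)
      (by rw [hsum]; ring) SpectralExcess.adjMatrix_distanceGraph_two rfl,
    SpectralExcess.avgBall_bound_of_quadratic hconn hreg hθ hspec hsum (ε := 1) (Or.inr rfl)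
      (by rw [hsum]; ring) SpectralExcess.adjMatrix_distanceGraph_one_two rfl⟩
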